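/- Let $H$ be a complex Hilbert space and let $P(H)\subset B(H)$ be the set of positive invertible bounded operators on $H$. For $x,y\in P(H)$ and $t\in[0,1]$ put $$d(x,y)=\bigl\|\ln\bigl(x^{-1/2}yx^{-1/2}\bigr)\bigr\|,\qquad \eta(x,y,t)=x^{1/2}\bigl(x^{-1/2}yx^{-1/2}\bigr)^{t}x^{1/2}\in P(H).$$ Then the following hold. (1) $(P(H),d)$ together with $\eta$ is a GCB-space. That is, $d$ is a complete metric on $P(H)$; $\eta$ is a geodesic bicombing, i.e. for all $x,y\in P(H)$ and $s,t\in[0,1]$ the curve $\eta(x,y,\cdot)$ is a geodesic from $x$ to $y$ (a $d$-continuous curve from $x$ to $y$ of length $d(x,y)$), $\eta(y,x,t)=\eta(x,y,1-t)$, $\eta(x,\eta(x,y,t),s)=\eta(x,y,ts)$, and $\eta(x_n,y_n,t)\to\eta(x,y,t)$ in $d$ whenever $x_n\to x$ and $y_n\to y$ in $d$; and $d$ is convex along $\eta$: $$d\bigl(\eta(x_1,x_2,t),\eta(y_1,y_2,t)\bigr)\le t\,d(x_2,y_2)+(1-t)\,d(x_1,y_1)$$ for all $x_1,x_2,y_1,y_2\in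 P(H)$ and $t\in[0,1]$. (2) For every invertible $A\in B(H)$ the map $f_A:x\mapsto A^*xA$ is a bijective isometry of $(P(H),d)$ which respects the bicombing, i.e. $f_A(\eta(x,y,t))=\eta(f_A(x),f_A(y),t)$ for all $x,y,t$. (3) $P(H)$ has property (C) when only isometries of the form $f_A:x\mapsto A^*xA$ with $A\in B(H)$ are considered. That is, let $(x_n)_{n\in\mathbb N}$ be a $d$-bounded sequence in $P(H)$ and let $\mathcal F$ be any family of isometries of $(P(H),d)$ into itself that respect the bicombing and are of the form $f_A$ with $A\in B(H)$, such that $d(x_n,f(x_n))\to0$ for every $f\in\mathcal F$. Then there is $z\in P(H)$ which is convex close to the sequence, i.e. $d(z,x_m)\le\operatorname{diam}_d\{x_n: n\in\mathbb N\}$ for all $m$, and which satisfies $f(z)=z$ for all $f\in\mathcal F$. (4) Such fixed points are obtained as weak-operator limit points: in the situation of (3), the sequence $(x_n)$ has a limit point (cluster point) in $B(H)$ for the weak operator topology, and every such limit point lies in $P(H)$, is convex close to $(x_n)$, and is fixed by every $f\in\mathcal F$. -/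

import Mathlib

open Filter Topology

/-! ### Metric spaces with a geodesic bicombing -/

section Bicombing

variable {X : Type*} [MetricSpace X]

/-- A geodesic from `x` to `y`: a continuous curve of length `dist x y` joining `x` to `y`. -/
def IsGeodesicCurve (γ : unitInterval → X) (x y : X) : Prop :=
  Continuous γ ∧ γ 0 = x ∧ γ 1 = y ∧ eVariationOn γ Set.univ = ENNReal.ofReal (dist x y)

/-- A geodesic bicombing `η : X × X × [0,1] → X`.
`unitInterval.symm t` is `1 - t`. -/
structure IsGeodesicBicombing (η : X → X → unitInterval → X) : Prop where
  geodesic : ∀ x y, IsGeodesicCurve (η x y) x y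
  reverse : ∀ x y t, η y x t = η x y (unitInterval.symm t)
  restrict : ∀ x y t s, η x (η x y t) s = η x y (t * s)
  continuous : ∀ (t : unitInterval) (u v : ℕ → X) (x y : X),
    Tendsto u atTop (𝓝 x) → Tendsto v atTop (𝓝 y) →
      Tendsto (fun n => η (u n) (v n) t) atTop (𝓝 (η x y t))

/-- A GCB-space: a complete metric space with a geodesic bicombing along which the metric
is convex. -/
structure IsGCBSpace (η : X → X → unitInterval → X) : Prop where
  complete : CompleteSpace X
  bicombing : IsGeodesicBicombing η
  convex : ∀ (x₁ x₂ y₁ y₂ : X) (t : unitInterval),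
    dist (η x₁ x₂ t) (η y₁ y₂ t) ≤ (t : ℝ) * dist x₂ y₂ + (1 - (t : ℝ)) * dist x₁ y₁

/-- The map `f` respects the bicombing `η`. -/
def RespectsBicombing (η : X → X → unitInterval → X) (f : X → X) : Prop :=
  ∀ x y t, f (η x y t) = η (f x) (f y) t

/-- The point `z` is convex close to the (bounded) set `A`. -/
def IsConvexClose (z : X) (A : Set X) : Prop :=
  ∀ a ∈ A, dist z a ≤ Metric.diam A

/-- The hypotheses of property (C), for maps taken from the class `S`: `x` is a bounded sequence
and `F` a family of bicombing respecting isometries belonging to `S`, each of which moves `x n`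
by a distance tending to `0`. -/
structure IsAsymptoticallyFixed (η : X → X → unitInterval → X) (S : Set (X → X))
    (x : ℕ → X) (F : Set (X → X)) : Prop where
  bounded : Bornology.IsBounded (Set.range x)
  mem : ∀ f ∈ F, f ∈ S
  isometry : ∀ f ∈ F, Isometry f
  respects : ∀ f ∈ F, RespectsBicombing η f
  tendsto : ∀ f ∈ F, Tendsto (fun n => dist (x n) (f (x n))) atTop (𝓝 0)

/-- Property (C) when considering only isometries from the class `S`. -/
def HasPropertyC (η : X → X → unitInterval → X) (S : Set (X → X)) : Prop :=
  ∀ (x : ℕ → X) (F : Set (X → X)), IsAsymptoticallyFixed η S x F →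
    ∃ z : X, IsConvexClose z (Set.range x) ∧ ∀ f ∈ F, f z = z

end Bicombing

/-! ### The cone of positive invertible operators -/

/-- The cone `P(H)` of positive invertible bounded operators on `H`. (A structure of its own, so
that it does not inherit the norm metric of `B(H)`.) -/
@[ext]
structure PosInv (H : Type*) [NormedAddCommGroup H] [InnerProductSpace ℂ H] [CompleteSpace H] where
  /-- the underlying operator -/
  val : H →L[ℂ] H
  pos : val.IsPositive
  isUnit : IsUnit val

namespace PosInv

variable {H : Type*} [NormedAddCommGroup H] [InnerProductSpace ℂ H] [CompleteSpace H]

theorem isStrictlyPositive (x : PosInv H) : IsStrictlyPositive x.val :=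
  ⟨(ContinuousLinearMap.nonneg_iff_isPositive _).2 x.pos, x.isUnit⟩

theorem isStrictlyPositive_conj {a b : H →L[ℂ] H} (ha : IsStrictlyPositive a)
    (hb : IsStrictlyPositive b) : IsStrictlyPositive (a * b * a) := by
  have hs : star a = a := (IsSelfAdjoint.of_nonneg ha.nonneg).star_eq
  refine ⟨?_, (ha.isUnit.mul hb.isUnit).mul ha.isUnit⟩
  have := star_left_conjugate_nonneg hb.nonneg a
  rwa [hs] at this

/-- The Thompson distance `‖ln (x^{-1/2} y x^{-1/2})‖`. -/
noncomputable def thompsonDist (x y : PosInv H) : ℝ :=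
  ‖CFC.log (x.val ^ (-(1 / 2) : ℝ) * y.val * x.val ^ (-(1 / 2) : ℝ))‖

/-- The curve `η(x,y,t) = x^{1/2} (x^{-1/2} y x^{-1/2})^t x^{1/2}`. -/
noncomputable def eta (x y : PosInv H) (t : unitInterval) : PosInv H :=
  have h : IsStrictlyPositive (x.val ^ (1 / 2 : ℝ) *
      (x.val ^ (-(1 / 2) : ℝ) * y.val * x.val ^ (-(1 / 2) : ℝ)) ^ (t : ℝ) *
      x.val ^ (1 / 2 : ℝ)) :=
    isStrictlyPositive_conj (.rpow _ _ x.isStrictlyPositive)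
      (.rpow _ _ (isStrictlyPositive_conj (.rpow _ _ x.isStrictlyPositive) y.isStrictlyPositive))
  { val := x.val ^ (1 / 2 : ℝ) *
      (x.val ^ (-(1 / 2) : ℝ) * y.val * x.val ^ (-(1 / 2) : ℝ)) ^ (t : ℝ) *
      x.val ^ (1 / 2 : ℝ)
    pos := (ContinuousLinearMap.nonneg_iff_isPositive _).1 h.nonneg
    isUnit := h.isUnit }

/-- The self-map `f` of `P(H)` is `f_A : x ↦ A* x A`. -/
def IsCongruenceBy (A : H →L[ℂ] H) (f : PosInv H → PosInv H) : Prop :=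
  ∀ x, (f x).val = ContinuousLinearMap.adjoint A * x.val * A

/-- The self-maps of `P(H)` of the form `x ↦ A* x A` with `A ∈ B(H)`. -/
def congruences (H : Type*) [NormedAddCommGroup H] [InnerProductSpace ℂ H] [CompleteSpace H] :
    Set (PosInv H → PosInv H) :=
  {f | ∃ A : H →L[ℂ] H, IsCongruenceBy A f}

/-- `T ∈ B(H)` is a limit (that is, cluster) point of the sequence `x` in the weak operator
topology. -/
def IsWOTLimitPoint (T : H →L[ℂ] H) (x : ℕ → PosInv H) : Prop :=
  MapClusterPt (ContinuousLinearMapWOT.ofCLM T) atTop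
    (fun n => ContinuousLinearMapWOT.ofCLM (x n).val)

end PosInv

open scoped NNReal InnerProductSpace

namespace PosInv

variable {H : Type*} [NormedAddCommGroup H] [InnerProductSpace ℂ H] [CompleteSpace H]

/-! ### The order description of the Thompson distance -/

/-! The metric is determined by the operator order: a bound `r` on the distance amounts to `x ≤ e^r
y` and `y ≤ e^r x` (`thompsonDist_le_iff`). The metric axioms and invariance under invertible
congruences become manipulations of inequalities.

Invertible congruences are isometries, act transitively and commute with the bicombing
(`eta_congruence`), so one endpoint may be taken to be `1`, where the geodesic is `t ↦ y ^ t`.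
Constant speed, reversal and restriction are then laws of powers and `log (y ^ s) = s • log y`;
convexity is the Löwner–Heinz inequality.

Order relations also survive weak operator limits, so the metric is weakly lower semicontinuous
(`dist_le_of_tendsto_inner`), and bounded sequences have weak limit points, which stay invertible.
Each map `x ↦ A* x A` is weakly continuous, so at such a limit `z` the distance from `z` to its
image is at most `lim d(x_n, f x_n) = 0`. Completeness follows from the same semicontinuity. -/

theorem nonneg (x : PosInv H) : 0 ≤ x.val := x.isStrictlyPositive.nonneg

/-- The element of `P(H)` given by a strictly positive operator. -/
def ofIsStrictlyPositive (a : H →L[ℂ] H) (ha : IsStrictlyPositive a) : PosInv H where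
  val := a
  pos := (ContinuousLinearMap.nonneg_iff_isPositive _).1 ha.nonneg
  isUnit := ha.isUnit

theorem star_conj_le_star_conj_iff {A : H →L[ℂ] H} (hA : IsUnit A) {a b : H →L[ℂ] H} :
    star A * a * A ≤ star A * b * A ↔ a ≤ b := by
  rw [← sub_nonneg, ← sub_mul, ← mul_sub, hA.star_left_conjugate_nonneg_iff, sub_nonneg]

theorem conj_rpow_le_conj_rpow_iff {c : H →L[ℂ] H} (hc : IsStrictlyPositive c) (s : ℝ)
    {a b : H →L[ℂ] H} : c ^ s * a * c ^ s ≤ c ^ s * b * c ^ s ↔ a ≤ b := by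
  have h := IsStrictlyPositive.rpow c s hc
  have := star_conj_le_star_conj_iff h.isUnit (a := a) (b := b)
  rwa [(IsSelfAdjoint.of_nonneg h.nonneg).star_eq] at this

/-- Both sides say that the spectrum of `z` lies in `[e^(-r), e^r]`. -/
theorem norm_log_le_iff {z : H →L[ℂ] H} (hz : IsStrictlyPositive z) {r : ℝ} (hr : 0 ≤ r) :
    ‖CFC.log z‖ ≤ r ↔ 1 ≤ Real.exp r • z ∧ z ≤ Real.exp r • 1 := by
  have hsa : IsSelfAdjoint z := .of_nonneg hz.nonneg
  have hpos : ∀ x ∈ spectrum ℝ z, 0 < x := fun x hx => hz.spectrum_pos hx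
  have hcont : ContinuousOn Real.log (spectrum ℝ z) :=
    Real.continuousOn_log.mono fun x hx => (hpos x hx).ne'
  have h1 : (1 : H →L[ℂ] H) ≤ Real.exp r • z ↔ algebraMap ℝ _ (Real.exp (-r)) ≤ z := by
    rw [Algebra.algebraMap_eq_smul_one]
    constructor <;> intro h
    · have := smul_le_smul_of_nonneg_left h (Real.exp_pos (-r)).le
      rwa [smul_smul, ← Real.exp_add, neg_add_cancel, Real.exp_zero, one_smul] at this
    · have := smul_le_smul_of_nonneg_left h (Real.exp_pos r).le
      rwa [smul_smul, ← Real.exp_add, add_neg_cancel, Real.exp_zero, one_smul] at this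
  rw [h1, ← Algebra.algebraMap_eq_smul_one, le_algebraMap_iff_spectrum_le hsa,
    algebraMap_le_iff_le_spectrum hsa, CFC.log, norm_cfc_le_iff _ _ hr hcont hsa, ← forall₂_and]
  refine forall₂_congr fun x hx => ?_
  rw [Real.norm_eq_abs, abs_le, Real.le_log_iff_exp_le (hpos x hx),
    Real.log_le_iff_le_exp (hpos x hx)]

theorem conj_rpow_neg_half (x : PosInv H) :
    x.val ^ (-(1 / 2) : ℝ) * x.val * x.val ^ (-(1 / 2) : ℝ) = 1 :=
  CFC.conjugate_rpow_neg_one_half x.val x.isStrictlyPositive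

/-- Conjugation by `x^(-1/2)` is an order isomorphism taking `x` to `1`, which reduces this to
`norm_log_le_iff`. -/
theorem thompsonDist_le_iff (x y : PosInv H) {r : ℝ} (hr : 0 ≤ r) :
    thompsonDist x y ≤ r ↔ x.val ≤ Real.exp r • y.val ∧ y.val ≤ Real.exp r • x.val := by
  have hx := x.isStrictlyPositive
  rw [thompsonDist, norm_log_le_iff
    (isStrictlyPositive_conj (.rpow _ _ hx) y.isStrictlyPositive) hr,
    ← conj_rpow_le_conj_rpow_iff hx (-(1 / 2)) (a := x.val),
    ← conj_rpow_le_conj_rpow_iff hx (-(1 / 2)) (a := y.val)]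
  simp only [mul_smul_comm, smul_mul_assoc, conj_rpow_neg_half]

theorem thompsonDist_nonneg (x y : PosInv H) : 0 ≤ thompsonDist x y := norm_nonneg _

theorem le_exp_thompsonDist_smul (x y : PosInv H) :
    x.val ≤ Real.exp (thompsonDist x y) • y.val :=
  ((thompsonDist_le_iff x y (thompsonDist_nonneg x y)).1 le_rfl).1

theorem le_exp_thompsonDist_smul' (x y : PosInv H) :
    y.val ≤ Real.exp (thompsonDist x y) • x.val :=
  ((thompsonDist_le_iff x y (thompsonDist_nonneg x y)).1 le_rfl).2

/-- A nonnegative real is determined by its nonnegative upper bounds, so symmetry and congruence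
invariance can be checked on order inequalities alone. -/
theorem thompsonDist_eq_of_forall_iff {x y x' y' : PosInv H}
    (h : ∀ r : ℝ, x.val ≤ Real.exp r • y.val ∧ y.val ≤ Real.exp r • x.val ↔
      x'.val ≤ Real.exp r • y'.val ∧ y'.val ≤ Real.exp r • x'.val) :
    thompsonDist x y = thompsonDist x' y' := by
  have h' : ∀ r : ℝ, 0 ≤ r → (thompsonDist x y ≤ r ↔ thompsonDist x' y' ≤ r) := fun r hr => by
    rw [thompsonDist_le_iff x y hr, thompsonDist_le_iff x' y' hr, h r]
  exact le_antisymm ((h' _ (thompsonDist_nonneg _ _)).2 le_rfl)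
    ((h' _ (thompsonDist_nonneg _ _)).1 le_rfl)

theorem thompsonDist_comm (x y : PosInv H) : thompsonDist x y = thompsonDist y x :=
  thompsonDist_eq_of_forall_iff fun _ => and_comm

theorem le_exp_add_smul {a b c : H →L[ℂ] H} {r s : ℝ} (hab : a ≤ Real.exp r • b)
    (hbc : b ≤ Real.exp s • c) : a ≤ Real.exp (r + s) • c := by
  rw [Real.exp_add, mul_smul]
  exact hab.trans (smul_le_smul_of_nonneg_left hbc (Real.exp_pos r).le)

theorem thompsonDist_triangle (x y z : PosInv H) :
    thompsonDist x z ≤ thompsonDist x y + thompsonDist y z := by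
  refine (thompsonDist_le_iff x z
    (add_nonneg (thompsonDist_nonneg x y) (thompsonDist_nonneg y z))).2
    ⟨le_exp_add_smul (le_exp_thompsonDist_smul x y) (le_exp_thompsonDist_smul y z), ?_⟩
  rw [add_comm]
  exact le_exp_add_smul (le_exp_thompsonDist_smul' y z) (le_exp_thompsonDist_smul' x y)

/-- The Thompson metric on `P(H)`. -/
noncomputable instance : MetricSpace (PosInv H) where
  dist := thompsonDist
  dist_self x := le_antisymm ((thompsonDist_le_iff x x le_rfl).2 (by simp))
    (thompsonDist_nonneg x x)
  dist_comm := thompsonDist_comm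
  dist_triangle := thompsonDist_triangle
  eq_of_dist_eq_zero {x y} h := by
    have := (thompsonDist_le_iff x y le_rfl).1 (le_of_eq h)
    simp only [Real.exp_zero, one_smul] at this
    exact PosInv.ext (le_antisymm this.1 this.2)

theorem dist_eq (x y : PosInv H) : dist x y = thompsonDist x y := rfl

theorem dist_le_iff {x y : PosInv H} {r : ℝ} (hr : 0 ≤ r) :
    dist x y ≤ r ↔ x.val ≤ Real.exp r • y.val ∧ y.val ≤ Real.exp r • x.val :=
  thompsonDist_le_iff x y hr

/-! ### Congruences -/

/-- The congruence `x ↦ A* x A` of `P(H)` for an invertible operator `A`. -/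
noncomputable def congruence (A : H →L[ℂ] H) (hA : IsUnit A) (x : PosInv H) : PosInv H where
  val := star A * x.val * A
  pos := (ContinuousLinearMap.nonneg_iff_isPositive _).1
    (hA.star_left_conjugate_nonneg_iff.2 x.nonneg)
  isUnit := (hA.star.mul x.isUnit).mul hA

theorem congruence_val (A : H →L[ℂ] H) (hA : IsUnit A) (x : PosInv H) :
    (congruence A hA x).val = star A * x.val * A := rfl

theorem isometry_congruence (A : H →L[ℂ] H) (hA : IsUnit A) : Isometry (congruence A hA) := by
  refine Isometry.of_dist_eq fun x y => thompsonDist_eq_of_forall_iff fun r => ?_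
  have h : ∀ z : PosInv H, Real.exp r • (congruence A hA z).val =
      star A * (Real.exp r • z.val) * A := fun z => by
    rw [congruence_val, mul_smul_comm, smul_mul_assoc]
  rw [h, h, congruence_val, congruence_val, star_conj_le_star_conj_iff hA,
    star_conj_le_star_conj_iff hA]

theorem congruence_congruence {A B : H →L[ℂ] H} (hA : IsUnit A) (hB : IsUnit B)
    (h : B * A = 1) (x : PosInv H) : congruence A hA (congruence B hB x) = x := by
  ext1
  have h' : star A * star B = 1 := by rw [← star_mul, h, star_one]
  calc star A * (star B * x.val * B) * A = (star A * star B) * x.val * (B * A) := by noncomm_ring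
    _ = x.val := by rw [h, h', one_mul, mul_one]

/-- The congruence `x ↦ A* x A` as a bijective isometry. -/
noncomputable def congruenceIsometryEquiv (A : (H →L[ℂ] H)ˣ) : PosInv H ≃ᵢ PosInv H where
  toFun := congruence A A.isUnit
  invFun := congruence ↑A⁻¹ A⁻¹.isUnit
  left_inv := congruence_congruence _ _ A.mul_inv
  right_inv := congruence_congruence _ _ A.inv_mul
  isometry_toFun := isometry_congruence _ _

/-- Conjugation by a unitary commutes with real powers. -/
theorem star_conj_rpow {U a : H →L[ℂ] H} (hU : U ∈ unitary (H →L[ℂ] H))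
    (ha : IsStrictlyPositive a) (t : ℝ) : (star U * a * U) ^ t = star U * a ^ t * U := by
  let φ := (Unitary.conjStarAlgAut ℂ (H →L[ℂ] H) (star ⟨U, hU⟩))
  have hφ : ∀ b, φ b = star U * b * U := fun b => by
    simp [φ, Unitary.conjStarAlgAut_apply]
  have hcont : Continuous φ := by
    rw [show (φ : _ → _) = fun b => star U * b * U from funext hφ]
    fun_prop
  have hnn : 0 ≤ φ a := by rw [hφ]; exact star_left_conjugate_nonneg ha.nonneg U
  have h := StarAlgHomClass.map_cfc (S := ℂ) φ (fun x : ℝ≥0 => x ^ t) a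
    (NNReal.continuousOn_rpow_const (.inl (spectrum.zero_notMem ℝ≥0 ha.isUnit))) hcont
    ha.nonneg hnn
  rw [hφ, hφ] at h
  exact h.symm

theorem eta_val (x y : PosInv H) (t : unitInterval) :
    (eta x y t).val = x.val ^ (1 / 2 : ℝ) *
      (x.val ^ (-(1 / 2) : ℝ) * y.val * x.val ^ (-(1 / 2) : ℝ)) ^ (t : ℝ) *
      x.val ^ (1 / 2 : ℝ) := rfl

/-- With `w = A* x A`, the operator `U = x^(1/2) A w^(-1/2)` is the unitary polar factor of `x^(1/2)
A`. It conjugates `x^(-1/2) y x^(-1/2)` to the corresponding operator for the transformed pair, and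
unitary conjugation passes through powers; the outer factors match because `U w^(1/2) = x^(1/2) A`.
-/
theorem eta_congruence (A : H →L[ℂ] H) (hA : IsUnit A) (x y : PosInv H) (t : unitInterval) :
    eta (congruence A hA x) (congruence A hA y) t = congruence A hA (eta x y t) := by
  ext1
  rw [congruence_val A hA (eta x y t)]
  have hwx : (congruence A hA x).val = star A * x.val * A := rfl
  generalize congruence A hA x = w at hwx ⊢
  have hp : ∀ (z : PosInv H) (s : ℝ), star (z.val ^ s) = z.val ^ s := fun z s =>
    (IsSelfAdjoint.of_nonneg CFC.rpow_nonneg).star_eq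
  have hxh : x.val ^ (1 / 2 : ℝ) * x.val ^ (1 / 2 : ℝ) = x.val := by
    rw [← CFC.rpow_add x.isUnit, add_halves, CFC.rpow_one _ x.nonneg]
  have hc1 : ∀ z : PosInv H, z.val ^ (-(1 / 2) : ℝ) * z.val ^ (1 / 2 : ℝ) = 1 := fun z =>
    CFC.rpow_neg_mul_rpow _ z.isStrictlyPositive
  have hc2 : ∀ z : PosInv H, z.val ^ (1 / 2 : ℝ) * z.val ^ (-(1 / 2) : ℝ) = 1 := fun z =>
    CFC.rpow_mul_rpow_neg _ z.isStrictlyPositive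
  set U := x.val ^ (1 / 2 : ℝ) * A * w.val ^ (-(1 / 2) : ℝ) with hU
  have hsU : star U = w.val ^ (-(1 / 2) : ℝ) * star A * x.val ^ (1 / 2 : ℝ) := by
    simp only [hU, star_mul, hp, mul_assoc]
  have hUU : star U * U = 1 := by
    rw [← conj_rpow_neg_half w, hsU, hU]
    calc _ = w.val ^ (-(1 / 2) : ℝ) * (star A * (x.val ^ (1 / 2 : ℝ) * x.val ^ (1 / 2 : ℝ)) * A) *
          w.val ^ (-(1 / 2) : ℝ) := by simp only [mul_assoc]
      _ = _ := by rw [hxh, ← hwx]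
  have hUunit : IsUnit U :=
    (((IsStrictlyPositive.rpow _ _ x.isStrictlyPositive).isUnit.mul hA).mul
      (IsStrictlyPositive.rpow _ _ w.isStrictlyPositive).isUnit)
  have hUmem : U ∈ unitary (H →L[ℂ] H) := by
    -- `U` is invertible, so its left inverse `star U` is also a right inverse.
    refine Unitary.mem_iff.2 ⟨hUU, ?_⟩
    exact hUunit.mul_right_cancel (by rw [mul_assoc, hUU, one_mul, mul_one])
  have hUw : U * w.val ^ (1 / 2 : ℝ) = x.val ^ (1 / 2 : ℝ) * A := by
    rw [hU, mul_assoc, hc1, mul_one]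
  have hwU : w.val ^ (1 / 2 : ℝ) * star U = star A * x.val ^ (1 / 2 : ℝ) := by
    rw [hsU, ← mul_assoc, ← mul_assoc, hc2, one_mul]
  set z := x.val ^ (-(1 / 2) : ℝ) * y.val * x.val ^ (-(1 / 2) : ℝ) with hz
  have hzpos : IsStrictlyPositive z :=
    isStrictlyPositive_conj (.rpow _ _ x.isStrictlyPositive) y.isStrictlyPositive
  have hconj : w.val ^ (-(1 / 2) : ℝ) * (congruence A hA y).val * w.val ^ (-(1 / 2) : ℝ) =
      star U * z * U := by
    rw [hsU, hU, hz, congruence_val]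
    calc _ = w.val ^ (-(1 / 2) : ℝ) * star A * 1 * y.val * 1 * A * w.val ^ (-(1 / 2) : ℝ) := by
          simp only [mul_assoc, one_mul]
      _ = w.val ^ (-(1 / 2) : ℝ) * star A * (x.val ^ (1 / 2 : ℝ) * x.val ^ (-(1 / 2) : ℝ)) * y.val *
          (x.val ^ (-(1 / 2) : ℝ) * x.val ^ (1 / 2 : ℝ)) * A * w.val ^ (-(1 / 2) : ℝ) := by
          rw [hc1, hc2]
      _ = _ := by simp only [mul_assoc]
  rw [eta_val, hconj, star_conj_rpow hUmem hzpos, eta_val, ← hz]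
  calc _ = (w.val ^ (1 / 2 : ℝ) * star U) * z ^ (t : ℝ) * (U * w.val ^ (1 / 2 : ℝ)) := by
        simp only [mul_assoc]
    _ = _ := by rw [hUw, hwU]; simp only [mul_assoc]

/-! ### The bicombing -/

/-- The identity operator as an element of `P(H)`. -/
noncomputable instance : One (PosInv H) := ⟨ofIsStrictlyPositive 1 ⟨zero_le_one, isUnit_one⟩⟩

theorem one_val : (1 : PosInv H).val = 1 := rfl

/-- Real powers of elements of `P(H)`. -/
noncomputable def rpow (x : PosInv H) (s : ℝ) : PosInv H :=
  ofIsStrictlyPositive (x.val ^ s) (.rpow _ _ x.isStrictlyPositive)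

theorem rpow_val (x : PosInv H) (s : ℝ) : (rpow x s).val = x.val ^ s := rfl

theorem eta_one_left (y : PosInv H) (t : unitInterval) : eta 1 y t = rpow y t := by
  ext1
  rw [eta_val, one_val, CFC.one_rpow, CFC.one_rpow]
  simp only [one_mul, mul_one, rpow_val]

theorem rpow_rpow (y : PosInv H) (s t : ℝ) : rpow (rpow y s) t = rpow y (s * t) := by
  ext1
  simp only [rpow_val]
  rcases eq_or_ne s 0 with rfl | hs
  · rw [zero_mul, CFC.rpow_zero _ y.nonneg, CFC.one_rpow]
  · exact CFC.rpow_rpow _ _ _ hs y.isStrictlyPositive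

theorem rpow_add_val (y : PosInv H) (s t : ℝ) :
    y.val ^ (s + t) = y.val ^ s * y.val ^ t := CFC.rpow_add y.isUnit

theorem rpow_one (y : PosInv H) : rpow y 1 = y := by
  ext1
  exact CFC.rpow_one _ y.nonneg

theorem rpow_zero (y : PosInv H) : rpow y 0 = 1 := by
  ext1
  exact CFC.rpow_zero _ y.nonneg

theorem isUnit_rpow_val (x : PosInv H) (s : ℝ) : IsUnit (x.val ^ s) :=
  (IsStrictlyPositive.rpow _ _ x.isStrictlyPositive).isUnit

theorem congruence_rpow_val (x y : PosInv H) (s : ℝ) :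
    (congruence (x.val ^ s) (x.isUnit_rpow_val s) y).val = x.val ^ s * y.val * x.val ^ s := by
  rw [congruence_val, (IsSelfAdjoint.of_nonneg CFC.rpow_nonneg).star_eq]

/-- Every pair of points is congruent to a pair of the form `(1, y')`. -/
theorem exists_congruence_one (x y : PosInv H) :
    ∃ (A : H →L[ℂ] H) (hA : IsUnit A) (y' : PosInv H),
      congruence A hA 1 = x ∧ congruence A hA y' = y := by
  refine ⟨_, x.isUnit_rpow_val (1 / 2),
    congruence _ (x.isUnit_rpow_val (-(1 / 2))) y, ?_, ?_⟩
  · ext1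
    rw [congruence_rpow_val, one_val, mul_one, ← rpow_add_val, add_halves,
      CFC.rpow_one _ x.nonneg]
  · exact congruence_congruence _ _ (CFC.rpow_neg_mul_rpow _ x.isStrictlyPositive) y

theorem log_rpow {z : H →L[ℂ] H} (hz : IsStrictlyPositive z) (s : ℝ) :
    CFC.log (z ^ s) = s • CFC.log z := by
  have hsa : IsSelfAdjoint z := .of_nonneg hz.nonneg
  have hpos : ∀ x ∈ spectrum ℝ z, 0 < x := fun x hx => hz.spectrum_pos hx
  have hpow : ContinuousOn (fun x : ℝ => x ^ s) (spectrum ℝ z) := fun x hx =>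
    (Real.continuousAt_rpow_const _ _ (.inl (hpos x hx).ne')).continuousWithinAt
  have hlog : ContinuousOn Real.log (spectrum ℝ z) :=
    Real.continuousOn_log.mono fun x hx => (hpos x hx).ne'
  have hlog' : ContinuousOn Real.log ((fun x : ℝ => x ^ s) '' spectrum ℝ z) := by
    refine Real.continuousOn_log.mono ?_
    rintro _ ⟨x, hx, rfl⟩
    exact (Real.rpow_pos_of_pos (hpos x hx) s).ne'
  rw [CFC.log, CFC.rpow_eq_cfc_real hz.nonneg, ← cfc_comp' Real.log _ z hlog' hpow hsa, CFC.log,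
    ← cfc_smul s Real.log z hlog]
  exact cfc_congr fun x hx => Real.log_rpow (hpos x hx) s

theorem dist_one_left (y : PosInv H) : dist 1 y = ‖CFC.log y.val‖ := by
  rw [dist_eq, thompsonDist, one_val, CFC.one_rpow, one_mul, mul_one]

/-- Congruence by `y^(-s/2)` sends `y^s` to `1` and `y^t` to `y^(t-s)`, leaving the norm of `(t - s)
• log y`. -/
theorem dist_rpow_rpow (y : PosInv H) (s t : ℝ) :
    dist (rpow y s) (rpow y t) = |t - s| * dist 1 y := by
  have h : congruence _ (y.isUnit_rpow_val (-(s / 2))) (rpow y s) = 1 := by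
    ext1
    rw [congruence_rpow_val, rpow_val, ← rpow_add_val, ← rpow_add_val, one_val,
      ← CFC.rpow_zero _ y.nonneg]
    ring_nf
  have h' : congruence _ (y.isUnit_rpow_val (-(s / 2))) (rpow y t) = rpow y (t - s) := by
    ext1
    rw [congruence_rpow_val, rpow_val, ← rpow_add_val, ← rpow_add_val, rpow_val]
    ring_nf
  rw [← (isometry_congruence _ (y.isUnit_rpow_val (-(s / 2)))).dist_eq, h, h', dist_one_left,
    dist_one_left, rpow_val, log_rpow y.isStrictlyPositive, norm_smul, Real.norm_eq_abs]

theorem dist_eta_eta (x y : PosInv H) (s t : unitInterval) :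
    dist (eta x y s) (eta x y t) = |(t : ℝ) - s| * dist x y := by
  obtain ⟨A, hA, z, rfl, rfl⟩ := exists_congruence_one x y
  simp only [eta_congruence, (isometry_congruence A hA).dist_eq, eta_one_left, dist_rpow_rpow]

theorem eta_zero (x y : PosInv H) : eta x y 0 = x := by
  obtain ⟨A, hA, z, rfl, rfl⟩ := exists_congruence_one x y
  rw [eta_congruence, eta_one_left, Set.Icc.coe_zero, rpow_zero]

theorem eta_one (x y : PosInv H) : eta x y 1 = y := by
  obtain ⟨A, hA, z, rfl, rfl⟩ := exists_congruence_one x y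
  rw [eta_congruence, eta_one_left, Set.Icc.coe_one, rpow_one]

/-- All factors are powers of `y`, with exponents `1/2`, `-t`, `1/2`. This is what reversal of the
bicombing reduces to at base point `1`. -/
theorem eta_one_right (y : PosInv H) (t : unitInterval) : eta y 1 t = rpow y (1 - t) := by
  ext1
  have h : y.val ^ (-(1 / 2) : ℝ) * y.val ^ (-(1 / 2) : ℝ) = (rpow y (-1)).val := by
    rw [← rpow_add_val, rpow_val]
    norm_num
  rw [eta_val, one_val, mul_one, h, ← rpow_val (rpow y (-1)), rpow_rpow, rpow_val, rpow_val, ← rpow_add_val,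
    ← rpow_add_val]
  ring_nf

theorem eta_reverse (x y : PosInv H) (t : unitInterval) :
    eta y x t = eta x y (unitInterval.symm t) := by
  obtain ⟨A, hA, z, rfl, rfl⟩ := exists_congruence_one x y
  rw [eta_congruence, eta_congruence, eta_one_left, eta_one_right, unitInterval.coe_symm_eq]

theorem eta_eta (x y : PosInv H) (t s : unitInterval) :
    eta x (eta x y t) s = eta x y (t * s) := by
  obtain ⟨A, hA, z, rfl, rfl⟩ := exists_congruence_one x y
  rw [eta_congruence, eta_congruence, eta_congruence, eta_one_left, eta_one_left, eta_one_left,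
    rpow_rpow, Set.Icc.coe_mul]

/-! ### Convexity of the metric along the bicombing -/

theorem smul_rpow {z : H →L[ℂ] H} (hz : IsStrictlyPositive z) {c : ℝ} (hc : 0 < c) (s : ℝ) :
    (c • z) ^ s = c ^ s • z ^ s := by
  have hsa : IsSelfAdjoint z := .of_nonneg hz.nonneg
  have hpos : ∀ x ∈ spectrum ℝ z, 0 < x := fun x hx => hz.spectrum_pos hx
  have hpow : ContinuousOn (fun x : ℝ => x ^ s) (spectrum ℝ z) := fun x hx =>
    (Real.continuousAt_rpow_const _ _ (.inl (hpos x hx).ne')).continuousWithinAt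
  have hpow' : ContinuousOn (fun x : ℝ => x ^ s) ((c • ·) '' spectrum ℝ z) := by
    rintro _ ⟨x, hx, rfl⟩
    exact (Real.continuousAt_rpow_const _ _
      (.inl (mul_pos hc (hpos x hx)).ne')).continuousWithinAt
  rw [CFC.rpow_eq_cfc_real (smul_nonneg hc.le hz.nonneg), CFC.rpow_eq_cfc_real hz.nonneg,
    ← cfc_comp_smul c _ z hpow' hsa, ← cfc_smul (c ^ s) _ z hpow]
  exact cfc_congr fun x hx => Real.mul_rpow hc.le (hpos x hx).le

/-- Löwner–Heinz: powers with exponent in `[0,1]` are operator monotone, and the scalar `e^r` comes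
out as `e^(tr)`. -/
theorem rpow_le_exp_smul_rpow {x y : PosInv H} {r : ℝ} (h : x.val ≤ Real.exp r • y.val)
    (t : unitInterval) : (rpow x t).val ≤ Real.exp (t * r) • (rpow y t).val := by
  rw [mul_comm, Real.exp_mul, rpow_val, rpow_val,
    ← smul_rpow y.isStrictlyPositive (Real.exp_pos r)]
  exact CFC.rpow_le_rpow t.2 h

theorem dist_eta_right_le (x y y' : PosInv H) (t : unitInterval) :
    dist (eta x y t) (eta x y' t) ≤ t * dist y y' := by
  obtain ⟨A, hA, z, rfl, rfl⟩ := exists_congruence_one x y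
  obtain ⟨z', rfl⟩ : ∃ z', congruence A hA z' = y' :=
    ⟨_, (congruenceIsometryEquiv hA.unit).apply_symm_apply y'⟩
  simp only [eta_congruence, (isometry_congruence A hA).dist_eq, eta_one_left]
  exact (dist_le_iff (mul_nonneg t.2.1 dist_nonneg)).2
    ⟨rpow_le_exp_smul_rpow (le_exp_thompsonDist_smul z z') t,
      rpow_le_exp_smul_rpow (le_exp_thompsonDist_smul' z z') t⟩

theorem dist_eta_left_le (x x' y : PosInv H) (t : unitInterval) :
    dist (eta x y t) (eta x' y t) ≤ (1 - t) * dist x x' := by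
  rw [eta_reverse y x, eta_reverse y x', ← unitInterval.coe_symm_eq]
  exact dist_eta_right_le _ _ _ _

/-- The intermediate point `eta x₁ y₂ t` changes one endpoint at a time. -/
theorem dist_eta_le (x₁ x₂ y₁ y₂ : PosInv H) (t : unitInterval) :
    dist (eta x₁ x₂ t) (eta y₁ y₂ t) ≤ (t : ℝ) * dist x₂ y₂ + (1 - (t : ℝ)) * dist x₁ y₁ :=
  (dist_triangle _ (eta x₁ y₂ t) _).trans
    (add_le_add (dist_eta_right_le _ _ _ _) (dist_eta_left_le _ _ _ _))

theorem tendsto_eta {u v : ℕ → PosInv H} {x y : PosInv H} (hu : Tendsto u atTop (𝓝 x))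
    (hv : Tendsto v atTop (𝓝 y)) (t : unitInterval) :
    Tendsto (fun n => eta (u n) (v n) t) atTop (𝓝 (eta x y t)) := by
  rw [tendsto_iff_dist_tendsto_zero] at hu hv ⊢
  refine squeeze_zero (fun _ => dist_nonneg) (fun n => dist_eta_le (u n) (v n) x y t) ?_
  simpa using (hv.const_mul (t : ℝ)).add (hu.const_mul (1 - (t : ℝ)))

end PosInv

/-- A curve on the unit interval of constant speed `dist x y` from `x` to `y` is a geodesic. -/
theorem isGeodesicCurve_of_dist_eq {X : Type*} [MetricSpace X] {γ : unitInterval → X} {x y : X}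
    (h₀ : γ 0 = x) (h₁ : γ 1 = y)
    (h : ∀ s t : unitInterval, dist (γ s) (γ t) = |(t : ℝ) - s| * dist x y) :
    IsGeodesicCurve γ x y := by
  refine ⟨?_, h₀, h₁, le_antisymm ?_ ?_⟩
  · refine (LipschitzWith.of_dist_le_mul (K := ⟨dist x y, dist_nonneg⟩) fun s t => ?_).continuous
    rw [h, mul_comm, abs_sub_comm]
    rfl
  · refine iSup_le fun ⟨n, u, hu, _⟩ => ?_
    have hle : ∀ i, edist (γ (u (i + 1))) (γ (u i)) =
        ENNReal.ofReal (((u (i + 1) : ℝ) - u i) * dist x y) := fun i => by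
      have hi : (u i : ℝ) ≤ u (i + 1) := hu (Nat.le_succ i)
      rw [edist_dist, h, abs_sub_comm, abs_of_nonneg (sub_nonneg.2 hi)]
    simp only [hle]
    rw [← ENNReal.ofReal_sum_of_nonneg fun i _ => mul_nonneg
      (sub_nonneg.2 (show (u i : ℝ) ≤ u (i + 1) from hu (Nat.le_succ i))) dist_nonneg,
      ← Finset.sum_mul, Finset.sum_range_sub (fun i => (u i : ℝ))]
    refine ENNReal.ofReal_le_ofReal (mul_le_of_le_one_left dist_nonneg ?_)
    linarith [(u n).2.2, (u 0).2.1]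
  · rw [← edist_dist, ← h₀, ← h₁]
    exact eVariationOn.edist_le γ (Set.mem_univ _) (Set.mem_univ _)

namespace PosInv

variable {H : Type*} [NormedAddCommGroup H] [InnerProductSpace ℂ H] [CompleteSpace H]

theorem isGeodesicBicombing_eta : IsGeodesicBicombing (eta (H := H)) where
  geodesic x y := isGeodesicCurve_of_dist_eq (eta_zero x y) (eta_one x y) (dist_eta_eta x y)
  reverse := eta_reverse
  restrict := eta_eta
  continuous t _ _ _ _ hu hv := tendsto_eta hu hv t

end PosInv

/-! ### The weak operator topology on `B(H)` -/

section WOT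

variable {H : Type*} [NormedAddCommGroup H] [InnerProductSpace ℂ H]

/-- By the Riesz representation, every functional in the definition of the topology is an inner
product. -/
theorem tendsto_ofCLM_iff_inner [CompleteSpace H] {α : Type*} {l : Filter α} {f : α → H →L[ℂ] H} {T : H →L[ℂ] H} :
    Tendsto (fun a => ContinuousLinearMapWOT.ofCLM (f a)) l (𝓝 (ContinuousLinearMapWOT.ofCLM T)) ↔
      ∀ v w : H, Tendsto (fun a => ⟪w, f a v⟫_ℂ) l (𝓝 ⟪w, T v⟫_ℂ) := by
  rw [ContinuousLinearMapWOT.tendsto_iff_forall_dual_apply_tendsto]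
  refine forall_congr' fun v => ⟨fun h w => h (InnerProductSpace.toDual ℂ H w), fun h y => ?_⟩
  obtain ⟨w, rfl⟩ := (InnerProductSpace.toDual ℂ H).surjective y
  exact h w

/-- Over `ℂ`, positivity says that each `⟪T v, v⟫` is real and nonnegative, a closed condition on
matrix coefficients. -/
theorem nonneg_of_tendsto_inner {α : Type*} {l : Filter α} [l.NeBot] {f : α → H →L[ℂ] H}
    {T : H →L[ℂ] H} (h : ∀ v w : H, Tendsto (fun a => ⟪w, f a v⟫_ℂ) l (𝓝 ⟪w, T v⟫_ℂ))
    (hf : ∀ᶠ a in l, 0 ≤ f a) : 0 ≤ T := by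
  simp only [ContinuousLinearMap.nonneg_iff_isPositive,
    ContinuousLinearMap.isPositive_iff_complex] at hf ⊢
  intro v
  have h' : Tendsto (fun a => ⟪f a v, v⟫_ℂ) l (𝓝 ⟪T v, v⟫_ℂ) := by
    have := (Complex.continuous_conj.tendsto _).comp (h v v)
    simpa only [Function.comp_def, inner_conj_symm] using this
  have hre : Tendsto (fun a => RCLike.re ⟪f a v, v⟫_ℂ) l (𝓝 (RCLike.re ⟪T v, v⟫_ℂ)) :=
    (Complex.continuous_re.tendsto _).comp h'
  refine ⟨tendsto_nhds_unique (((Complex.continuous_ofReal.tendsto _).comp hre).congr' ?_) h',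
    ge_of_tendsto hre (hf.mono fun a ha => (ha v).2)⟩
  exact hf.mono fun a ha => (ha v).1

/-- A norm-bounded net of operators has a weak operator limit along any ultrafilter. -/
theorem exists_tendsto_inner_of_norm_le [CompleteSpace H] {α : Type*} (U : Ultrafilter α) {f : α → H →L[ℂ] H}
    {M : ℝ} (hM : ∀ a, ‖f a‖ ≤ M) :
    ∃ T : H →L[ℂ] H, ∀ v w : H, Tendsto (fun a => ⟪w, f a v⟫_ℂ) U (𝓝 ⟪w, T v⟫_ℂ) := by
  have hbound : ∀ (v w : H) (a : α), ‖⟪f a v, w⟫_ℂ‖ ≤ M * ‖v‖ * ‖w‖ := fun v w a =>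
    (norm_inner_le_norm _ _).trans (mul_le_mul_of_nonneg_right
      ((f a).le_of_opNorm_le (hM a) v) (norm_nonneg w))
  have hlim : ∀ v w : H, ∃ z : ℂ, Tendsto (fun a => ⟪f a v, w⟫_ℂ) U (𝓝 z) := fun v w => by
    -- Each matrix coefficient stays in a compact disc of `ℂ`, so it converges along the
    -- ultrafilter.
    obtain ⟨z, -, hz⟩ := (isCompact_closedBall (0 : ℂ) (M * ‖v‖ * ‖w‖)).ultrafilter_le_nhds
      (U.map fun a => ⟪f a v, w⟫_ℂ) (by
        rw [Ultrafilter.coe_map, le_principal_iff]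
        exact mem_map.2 (Eventually.of_forall fun a => mem_closedBall_zero_iff.2 (hbound v w a)))
    exact ⟨z, hz⟩
  choose B hB using hlim
  -- Uniqueness of limits makes the limiting form sesquilinear, with the bound `M`; it is therefore
  -- represented by an operator.
  let B' : H →L⋆[ℂ] H →L[ℂ] ℂ := LinearMap.mkContinuous₂
    (LinearMap.mk₂'ₛₗ (starRingEnd ℂ) (RingHom.id ℂ) B
      (fun v v' w => tendsto_nhds_unique (hB _ _)
        (((hB v w).add (hB v' w)).congr fun a => by rw [map_add, inner_add_left]))
      (fun c v w => tendsto_nhds_unique (hB _ _)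
        (((hB v w).const_mul ((starRingEnd ℂ) c)).congr fun a => by rw [map_smul, inner_smul_left]))
      (fun v w w' => tendsto_nhds_unique (hB _ _)
        (((hB v w).add (hB v w')).congr fun a => by rw [inner_add_right]))
      (fun c v w => tendsto_nhds_unique (hB _ _)
        (((hB v w).const_mul c).congr fun a => by rw [inner_smul_right])))
    M fun v w => le_of_tendsto (hB v w).norm (Eventually.of_forall (hbound v w))
  refine ⟨InnerProductSpace.continuousLinearMapOfBilin B', fun v w => ?_⟩
  have h : Tendsto (fun a => ⟪f a v, w⟫_ℂ) U
      (𝓝 ⟪InnerProductSpace.continuousLinearMapOfBilin B' v, w⟫_ℂ) := by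
    rw [InnerProductSpace.continuousLinearMapOfBilin_apply]
    exact hB v w
  have := (Complex.continuous_conj.tendsto _).comp h
  simpa only [Function.comp_def, inner_conj_symm] using this

end WOT

/-! ### Lower semicontinuity of the metric and completeness -/

namespace PosInv

variable {H : Type*} [NormedAddCommGroup H] [InnerProductSpace ℂ H] [CompleteSpace H]

theorem le_smul_of_tendsto_inner {α : Type*} {l : Filter α} [l.NeBot] {f g : α → H →L[ℂ] H}
    {S T : H →L[ℂ] H} {c : ℝ} (hf : ∀ v w : H, Tendsto (fun a => ⟪w, f a v⟫_ℂ) l (𝓝 ⟪w, S v⟫_ℂ))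
    (hg : ∀ v w : H, Tendsto (fun a => ⟪w, g a v⟫_ℂ) l (𝓝 ⟪w, T v⟫_ℂ))
    (h : ∀ᶠ a in l, f a ≤ c • g a) : S ≤ c • T := by
  rw [← sub_nonneg]
  refine nonneg_of_tendsto_inner (f := fun a => c • g a - f a) (fun v w => ?_)
    (h.mono fun a ha => sub_nonneg.2 ha)
  have key : ∀ A B : H →L[ℂ] H, ⟪w, (c • A - B) v⟫_ℂ = (c : ℂ) * ⟪w, A v⟫_ℂ - ⟪w, B v⟫_ℂ :=
    fun A B => by
      rw [_root_.sub_apply, _root_.smul_apply, inner_sub_right,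
        ← Complex.coe_smul, inner_smul_right]
  simp only [key]
  exact ((hg v w).const_mul _).sub (hf v w)

/-- The Thompson metric is lower semicontinuous for the weak operator topology. -/
theorem dist_le_of_tendsto_inner {α : Type*} {l : Filter α} [l.NeBot] {x y : α → PosInv H}
    {z z' : PosInv H} {r : ℝ} (hr : 0 ≤ r)
    (hx : ∀ v w : H, Tendsto (fun a => ⟪w, (x a).val v⟫_ℂ) l (𝓝 ⟪w, z.val v⟫_ℂ))
    (hy : ∀ v w : H, Tendsto (fun a => ⟪w, (y a).val v⟫_ℂ) l (𝓝 ⟪w, z'.val v⟫_ℂ))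
    (h : ∀ᶠ a in l, dist (x a) (y a) ≤ r) : dist z z' ≤ r := by
  simp only [dist_le_iff hr] at h ⊢
  exact ⟨le_smul_of_tendsto_inner hx hy (h.mono fun _ => And.left),
    le_smul_of_tendsto_inner hy hx (h.mono fun _ => And.right)⟩

/-- Weak operator limits of bounded nets in `P(H)` lie in `P(H)`. -/
theorem exists_val_eq_of_tendsto_inner {α : Type*} {l : Filter α} [l.NeBot] {x : α → PosInv H}
    {T : H →L[ℂ] H} (hx : ∀ v w : H, Tendsto (fun a => ⟪w, (x a).val v⟫_ℂ) l (𝓝 ⟪w, T v⟫_ℂ))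
    {y : PosInv H} {r : ℝ} (hr : 0 ≤ r) (h : ∀ᶠ a in l, dist (x a) y ≤ r) :
    ∃ z : PosInv H, z.val = T := by
  -- Invertibility alone could be lost in a weak limit; the uniform lower bound by the invertible
  -- `y` preserves it.
  have hle : y.val ≤ Real.exp r • T :=
    le_smul_of_tendsto_inner (fun _ _ => tendsto_const_nhds) hx
      (h.mono fun _ ha => ((dist_le_iff hr).1 ha).2)
  have h1 : IsUnit (Real.exp r • T) := CStarAlgebra.isUnit_of_le y.val hle y.isStrictlyPositive
  have h2 : IsUnit T := (isUnit_smul_iff (Units.mk0 _ (Real.exp_pos r).ne') T).1 h1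
  exact ⟨ofIsStrictlyPositive T
    ⟨nonneg_of_tendsto_inner hx (Eventually.of_forall fun a => (x a).nonneg), h2⟩, rfl⟩

theorem exists_norm_le_of_isBounded {x : ℕ → PosInv H}
    (hx : Bornology.IsBounded (Set.range x)) : ∃ M : ℝ, ∀ n, ‖(x n).val‖ ≤ M := by
  refine ⟨‖Real.exp (Metric.diam (Set.range x)) • (x 0).val‖, fun n =>
    CStarAlgebra.norm_le_norm_of_nonneg_of_le (x n).nonneg ?_⟩
  exact ((dist_le_iff Metric.diam_nonneg).1
    (Metric.dist_le_diam_of_mem hx (Set.mem_range_self n) (Set.mem_range_self 0))).1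

/-- The candidate limit is a weak limit along an ultrafilter; lower semicontinuity turns the Cauchy
estimate `d(u n, u m) < ε/2` into `d(z, u m) ≤ ε/2`. -/
instance : CompleteSpace (PosInv H) := by
  refine Metric.complete_of_cauchySeq_tendsto fun u hu => ?_
  have hb := hu.isBounded_range
  obtain ⟨M, hM⟩ := exists_norm_le_of_isBounded hb
  obtain ⟨T, hT⟩ := exists_tendsto_inner_of_norm_le (hyperfilter ℕ) hM
  obtain ⟨z, rfl⟩ := exists_val_eq_of_tendsto_inner hT (y := u 0) Metric.diam_nonneg
    (Eventually.of_forall fun n =>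
      Metric.dist_le_diam_of_mem hb (Set.mem_range_self n) (Set.mem_range_self 0))
  refine ⟨z, Metric.tendsto_atTop.2 fun ε hε => ?_⟩
  obtain ⟨N, hN⟩ := Metric.cauchySeq_iff.1 hu (ε / 2) (half_pos hε)
  refine ⟨N, fun m hm => ?_⟩
  rw [dist_comm]
  refine (dist_le_of_tendsto_inner (half_pos hε).le hT (fun _ _ => tendsto_const_nhds) ?_).trans_lt
    (half_lt_self hε)
  exact ((eventually_ge_atTop N).filter_mono Nat.hyperfilter_le_atTop).mono fun n hn => (hN n hn m hm).le

/-! ### Weak operator limit points of asymptotically fixed sequences -/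

theorem exists_isWOTLimitPoint {x : ℕ → PosInv H} (hx : Bornology.IsBounded (Set.range x)) :
    ∃ T : H →L[ℂ] H, IsWOTLimitPoint T x := by
  obtain ⟨M, hM⟩ := exists_norm_le_of_isBounded hx
  obtain ⟨T, hT⟩ := exists_tendsto_inner_of_norm_le (hyperfilter ℕ) hM
  exact ⟨T, mapClusterPt_iff_ultrafilter.2
    ⟨hyperfilter ℕ, Nat.hyperfilter_le_atTop, tendsto_ofCLM_iff_inner.2 hT⟩⟩

/-- Lower semicontinuity is applied twice: against the constant sequence `x m` for convex closeness,
and to the pair `x n`, `f (x n)` for the fixed point property. -/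
theorem IsWOTLimitPoint.exists_fixed {T : H →L[ℂ] H} {x : ℕ → PosInv H} (hT : IsWOTLimitPoint T x)
    {η : PosInv H → PosInv H → unitInterval → PosInv H} {F : Set (PosInv H → PosInv H)}
    (h : IsAsymptoticallyFixed η (congruences H) x F) :
    ∃ z : PosInv H, z.val = T ∧ IsConvexClose z (Set.range x) ∧ ∀ f ∈ F, f z = z := by
  obtain ⟨U, hU, hlim⟩ := mapClusterPt_iff_ultrafilter.1 hT
  rw [tendsto_ofCLM_iff_inner] at hlim
  have hdiam : ∀ m n, dist (x n) (x m) ≤ Metric.diam (Set.range x) := fun m n =>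
    Metric.dist_le_diam_of_mem h.bounded (Set.mem_range_self n) (Set.mem_range_self m)
  obtain ⟨z, rfl⟩ := exists_val_eq_of_tendsto_inner hlim Metric.diam_nonneg
    (Eventually.of_forall (hdiam 0))
  refine ⟨z, rfl, ?_, fun f hf => ?_⟩
  · rintro _ ⟨m, rfl⟩
    exact dist_le_of_tendsto_inner Metric.diam_nonneg hlim (fun _ _ => tendsto_const_nhds)
      (Eventually.of_forall (hdiam m))
  · obtain ⟨A, hA⟩ := h.mem f hf
    have hlim' : ∀ v w : H, Tendsto (fun n => ⟪w, (f (x n)).val v⟫_ℂ) U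
        (𝓝 ⟪w, (f z).val v⟫_ℂ) := fun v w => by
      -- Moving `A*` across the inner product exhibits the weak operator continuity of `f`.
      have key : ∀ y, ⟪w, (f y).val v⟫_ℂ = ⟪A w, y.val (A v)⟫_ℂ := fun y => by
        rw [hA y, mul_assoc, mul_apply_eq_comp, mul_apply_eq_comp,
          ContinuousLinearMap.adjoint_inner_right]
      simp only [key]
      exact hlim (A v) (A w)
    refine (dist_le_zero.1 (le_of_forall_pos_le_add fun ε hε => ?_)).symm
    rw [zero_add]
    exact dist_le_of_tendsto_inner hε.le hlim hlim'
      (hU ((h.tendsto f hf).eventually_le_const hε))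

end PosInv

theorem mainTheorem8 (H : Type*) [NormedAddCommGroup H] [InnerProductSpace ℂ H]
    [CompleteSpace H] :
    ∃ _ : MetricSpace (PosInv H),
      (∀ x y : PosInv H, dist x y = PosInv.thompsonDist x y) ∧
      IsGCBSpace (PosInv.eta (H := H)) ∧
      (∀ A : H →L[ℂ] H, IsUnit A → ∃ f : PosInv H ≃ᵢ PosInv H,
        PosInv.IsCongruenceBy A f ∧ RespectsBicombing PosInv.eta f) ∧
      HasPropertyC PosInv.eta (PosInv.congruences H) ∧
      (∀ (x : ℕ → PosInv H) (F : Set (PosInv H → PosInv H)),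
        IsAsymptoticallyFixed PosInv.eta (PosInv.congruences H) x F →
          (∃ T : H →L[ℂ] H, PosInv.IsWOTLimitPoint T x) ∧
          ∀ T : H →L[ℂ] H, PosInv.IsWOTLimitPoint T x →
            ∃ z : PosInv H, z.val = T ∧ IsConvexClose z (Set.range x) ∧ ∀ f ∈ F, f z = z) := by
  refine ⟨inferInstance, PosInv.dist_eq,
    ⟨inferInstance, PosInv.isGeodesicBicombing_eta, PosInv.dist_eta_le⟩, fun A hA => ?_,
    fun x F h => ?_, fun x F h => ⟨PosInv.exists_isWOTLimitPoint h.bounded,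
      fun T hT => hT.exists_fixed h⟩⟩
  · exact ⟨PosInv.congruenceIsometryEquiv hA.unit, fun _ => rfl,
      fun x y t => (PosInv.eta_congruence _ hA.unit.isUnit x y t).symm⟩
  · obtain ⟨T, hT⟩ := PosInv.exists_isWOTLimitPoint h.bounded
    obtain ⟨z, -, hz⟩ := hT.exists_fixed h
    exact ⟨z, hz⟩
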